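/- For $r\in(0,1)$ let $f_1,f_2,f_3:\mathbb R^2\to\mathbb R^2$ be the homotheties $f_i(x)=rx+(1-r)x_i$ of ratio $r$ fixing the vertices $x_1=(0,0)$, $x_2=(1,0)$, $x_3=(\tfrac12,\tfrac{\sqrt3}{2})$ of the unit equilateral triangle, let $S_r$ be the associated self-similar set (Sierpinski gasket), i.e. the unique nonempty compact set with $S_r=f_1(S_r)\cup f_2(S_r)\cup f_3(S_r)$, and let $s(r)=-\log 3/\log r$. For $s>0$, $\delta>0$ and $A\subset\mathbb R^2$ let $P^s_\delta(A)=\sup\sum_i|B_i|^s$, where $|B|$ denotes the diameter of $B$ and the supremum is over all countable (finite or infinite) collections $\{B_i\}$ of pairwise disjoint closed Euclidean balls with centres in $A$, positive radii and diameters at most $\delta$; let $P^s_0(A)=\lim_{\delta\to0^+}P^s_\delta(A)$, and let the packing measure be $$P^s(A)=\inf\Big\{\sum_{i=1}^\infty P^s_0(U_i)\;:\;A\subset\bigcup_{i=1}^\infty U_i\Big\}.$$ Then for every $r\in(0,\tfrac13]$, $$P^{s(r)}(S_r)=\Big(2\,\frac{1-r}{r}\Big)^{s(r)}.$$ -/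

import Mathlib

open scoped ENNReal NNReal

noncomputable section

/-! ### Packing measures on Euclidean space -/

/-- A `δ`-packing of `A ⊆ ℝⁿ`: a countable (finite or infinite) collection of pairwise disjoint
closed balls with centre in `A`, positive radius and diameter at most `δ`. A ball is recorded by the
pair (centre, radius). -/
structure IsPacking {n : ℕ} (A : Set (EuclideanSpace ℝ (Fin n))) (δ : ℝ≥0∞)
    (t : Set (EuclideanSpace ℝ (Fin n) × ℝ)) : Prop where
  countable : t.Countable
  center_mem : ∀ p ∈ t, p.1 ∈ A
  radius_pos : ∀ p ∈ t, 0 < p.2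
  ediam_le : ∀ p ∈ t, Metric.ediam (Metric.closedBall p.1 p.2) ≤ δ
  disjoint : t.PairwiseDisjoint fun p => Metric.closedBall p.1 p.2

/-- `P_δ^s(A)`: the supremum of `∑ |B_i| ^ s` over all `δ`-packings `{B_i}` of `A`. -/
def packingPremeasureAt {n : ℕ} (s : ℝ) (δ : ℝ≥0∞) (A : Set (EuclideanSpace ℝ (Fin n))) : ℝ≥0∞ :=
  ⨆ (t : Set (EuclideanSpace ℝ (Fin n) × ℝ)) (_ : IsPacking A δ t),
    ∑' p : t, Metric.ediam (Metric.closedBall p.1.1 p.1.2) ^ s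

/-- The packing premeasure `P_0^s(A) = lim_{δ → 0} P_δ^s(A)`; since `P_δ^s(A)` is non-decreasing in
`δ`, the limit is the infimum over `δ > 0`
(see `tendsto_packingPremeasureAt`). -/
def packingPremeasure {n : ℕ} (s : ℝ) (A : Set (EuclideanSpace ℝ (Fin n))) : ℝ≥0∞ :=
  ⨅ (δ : ℝ≥0∞) (_ : 0 < δ), packingPremeasureAt s δ A

theorem packingPremeasureAt_mono {n : ℕ} (s : ℝ) (A : Set (EuclideanSpace ℝ (Fin n))) :
    Monotone fun δ : ℝ≥0∞ => packingPremeasureAt s δ A := by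
  intro δ ε h
  refine iSup₂_le fun t ht => ?_
  exact le_iSup₂_of_le t
    ⟨ht.countable, ht.center_mem, ht.radius_pos, fun p hp => (ht.ediam_le p hp).trans h,
      ht.disjoint⟩ le_rfl

theorem tendsto_packingPremeasureAt {n : ℕ} (s : ℝ) (A : Set (EuclideanSpace ℝ (Fin n))) :
    Filter.Tendsto (fun δ : ℝ≥0∞ => packingPremeasureAt s δ A) (nhdsWithin 0 (Set.Ioi 0))
      (nhds (packingPremeasure s A)) := by
  have h := (packingPremeasureAt_mono s A).tendsto_nhdsGT 0
  rwa [sInf_image] at h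

/-- The `s`-dimensional packing measure: the infimum of `∑ P_0^s(U_i)` over all countable covers
`{U_i}` of `A`. -/
def packingMeasure {n : ℕ} (s : ℝ) (A : Set (EuclideanSpace ℝ (Fin n))) : ℝ≥0∞ :=
  ⨅ (U : ℕ → Set (EuclideanSpace ℝ (Fin n))) (_ : A ⊆ ⋃ i, U i),
    ∑' i, packingPremeasure s (U i)

/-! ### Self-similar sets -/

/-- `K` is invariant for the system `f`: nonempty, compact, and `K = ⋃ i, f i (K)`. -/
structure IsSelfSimilarSet {ι X : Type*} [TopologicalSpace X] (f : ι → X → X) (K : Set X) :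
    Prop where
  nonempty : K.Nonempty
  isCompact : IsCompact K
  eq_iUnion : K = ⋃ i, f i '' K

/-- A finite system of contractions of a complete metric space has exactly one invariant nonempty
compact set. -/
theorem existsUnique_isSelfSimilarSet {ι X : Type*} [Finite ι] [Nonempty ι] [MetricSpace X]
    [CompleteSpace X] [Nonempty X] (f : ι → X → X) (c : ℝ≥0) (hc : c < 1)
    (hf : ∀ i, LipschitzWith c (f i)) : ∃! K : Set X, IsSelfSimilarSet f K := by
  let T : TopologicalSpace.NonemptyCompacts X → TopologicalSpace.NonemptyCompacts X := fun K =>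
    ⟨⟨⋃ i, f i '' (K : Set X),
      isCompact_iUnion fun i => K.isCompact.image (hf i).continuous⟩,
      Set.nonempty_iUnion.2 ⟨Classical.arbitrary ι, K.nonempty.image _⟩⟩
  have hTcoe : ∀ K, (T K : Set X) = ⋃ i, f i '' (K : Set X) := fun K => rfl
  have hT : ContractingWith c T := by
    refine ⟨hc, fun K L => ?_⟩
    change Metric.hausdorffEDist (T K : Set X) (T L : Set X)
      ≤ c * Metric.hausdorffEDist (K : Set X) (L : Set X)
    rw [hTcoe, hTcoe]
    refine Metric.hausdorffEDist_iUnion_le.trans (iSup_le fun i => ?_)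
    have key : ∀ A B : Set X, IsCompact B → B.Nonempty → ∀ x ∈ A,
        ∃ y ∈ f i '' B, edist (f i x) y ≤ c * Metric.hausdorffEDist A B := by
      intro A B hB hBn x hx
      obtain ⟨y, hy, hxy⟩ := hB.exists_infEDist_eq_edist hBn x
      refine ⟨f i y, Set.mem_image_of_mem _ hy, (hf i x y).trans ?_⟩
      rw [← hxy]
      gcongr
      exact Metric.infEDist_le_hausdorffEDist_of_mem hx
    refine Metric.hausdorffEDist_le_of_mem_edist ?_ ?_
    · rintro _ ⟨x, hx, rfl⟩
      exact key _ _ L.isCompact L.nonempty x hx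
    · rintro _ ⟨x, hx, rfl⟩
      rw [Metric.hausdorffEDist_comm]
      exact key _ _ K.isCompact K.nonempty x hx
  refine ⟨(ContractingWith.fixedPoint T hT : TopologicalSpace.NonemptyCompacts X),
    ⟨TopologicalSpace.NonemptyCompacts.nonempty _, TopologicalSpace.NonemptyCompacts.isCompact _,
      ?_⟩, ?_⟩
  · rw [← hTcoe, hT.fixedPoint_isFixedPt.eq]
  · intro K hK
    have h : (⟨⟨K, hK.isCompact⟩, hK.nonempty⟩ : TopologicalSpace.NonemptyCompacts X)
        = ContractingWith.fixedPoint T hT :=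
      hT.fixedPoint_unique (SetLike.coe_injective hK.eq_iUnion.symm)
    exact congrArg (fun L : TopologicalSpace.NonemptyCompacts X => (L : Set X)) h

open Classical in
/-- The self-similar set of the system `f`: its invariant nonempty compact set (which exists and is
unique for a finite system of contractions of a complete metric space). -/
def selfSimilarSet {ι X : Type*} [TopologicalSpace X] (f : ι → X → X) : Set X :=
  if h : ∃ K, IsSelfSimilarSet f K then h.choose else ∅

/-! ### The Sierpinski gaskets -/

/-- The vertices `(0, 0)`, `(1, 0)`, `(1/2, √3/2)` of the unit equilateral triangle. -/
def triangleVertex : Fin 3 → EuclideanSpace ℝ (Fin 2) :=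
  ![!₂[0, 0], !₂[1, 0], !₂[1 / 2, √3 / 2]]

/-- The homotheties `x ↦ r x + (1 - r) v` of ratio `r` fixing the vertices `v` of the triangle. -/
def sierpinskiMap (r : ℝ) (i : Fin 3) (x : EuclideanSpace ℝ (Fin 2)) : EuclideanSpace ℝ (Fin 2) :=
  r • x + (1 - r) • triangleVertex i

/-- The Sierpinski gasket `S_r`. -/
def sierpinskiGasket (r : ℝ) : Set (EuclideanSpace ℝ (Fin 2)) :=
  selfSimilarSet (sierpinskiMap r)

/-- The similarity dimension `s(r)` of `S_r`. -/
def gasketDim (r : ℝ) : ℝ :=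
  -Real.log 3 / Real.log r

/-- For `0 < r < 1`, a set is invariant for the three homotheties exactly when it is `S_r`. -/
theorem isSelfSimilarSet_iff_eq_sierpinskiGasket {r : ℝ} (h0 : 0 < r) (h1 : r < 1)
    (K : Set (EuclideanSpace ℝ (Fin 2))) :
    IsSelfSimilarSet (sierpinskiMap r) K ↔ K = sierpinskiGasket r := by
  have hex : ∃! K, IsSelfSimilarSet (sierpinskiMap r) K := by
    refine existsUnique_isSelfSimilarSet _ ⟨r, h0.le⟩ h1 fun i => ?_
    refine LipschitzWith.of_dist_le_mul fun x y => le_of_eq ?_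
    simp only [sierpinskiMap, dist_add_right, dist_smul₀, Real.norm_eq_abs, abs_of_pos h0]
    rfl
  have hS : IsSelfSimilarSet (sierpinskiMap r) (sierpinskiGasket r) := by
    rw [sierpinskiGasket, selfSimilarSet, dif_pos hex.exists]
    exact hex.exists.choose_spec
  exact ⟨fun h => hex.unique h hS, fun h => h ▸ hS⟩

end

/-! Let μ be the image of the uniform Bernoulli measure under the coding map, and s = s(r), so that
r^s = 1/3. The value is the sharp constant relating |B|^s to μ(B) for small balls B centred in the
gasket.

Upper bound: `gauge_le_ballMass` gives |B|^s ≤ (2(1-r)/r)^s μ(B), and summing over a packing leaves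
at most the total mass 1. By self-similarity only radii in one period, 1-r < d ≤ (1-r)/r, matter.
From d = 1 on the ball has full mass. For d = 1-r+t < 1 it contains the whole first-level cell of
its centre, and in each of the other two cells a scaled copy of a ball of radius t/r about a vertex
(`le_ballMass_of_gap`). Such vertex balls carry at least half the gauge
(`half_gauge_le_ballMass_vertex`), and (1+u)^s ≤ 1+u^s finishes, since r ≤ 1/3 means s ≤ 1.

Lower bound: almost every code has arbitrarily late zero runs of any given length. At such a run the
centre is relatively very close to a corner of its cell, and a ball of radius r^k d with d < 1-r
misses all other cells of level k+1 (`ballMass_le_of_zero_run`). Hence |B|^s ≥ (2d/r)^s μ(B) at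
arbitrarily small scales, almost everywhere. Besicovitch's theorem turns these balls into packings
(`mul_measure_inter_lowDensityPoints_le`); then d → 1-r. -/

open MeasureTheory Filter Topology

noncomputable section

/-! ### The uniform Bernoulli measure on codes -/

/-- Prepend a letter to an infinite code. -/
def consCode {α : Type*} (i : α) (ω : ℕ → α) : ℕ → α
  | 0 => i
  | k + 1 => ω k

@[simp] theorem consCode_zero {α : Type*} (i : α) (ω : ℕ → α) : consCode i ω 0 = i := rfl

@[simp] theorem consCode_succ {α : Type*} (i : α) (ω : ℕ → α) (k : ℕ) :
    consCode i ω (k + 1) = ω k := rfl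

theorem consCode_head_tail {α : Type*} (ω : ℕ → α) :
    consCode (ω 0) (fun k => ω (k + 1)) = ω := by
  funext k
  cases k <;> rfl

theorem measurable_consCode (i : Fin 3) : Measurable (consCode i) := by
  refine measurable_pi_iff.2 fun k => ?_
  cases k with
  | zero => exact measurable_const
  | succ k => exact measurable_pi_apply k

/-- The product of the uniform measures on three letters. -/
def codeMeasure : Measure (ℕ → Fin 3) :=
  Measure.infinitePi fun _ => ProbabilityTheory.uniformOn (Set.univ : Set (Fin 3))

instance : IsProbabilityMeasure codeMeasure := by
  unfold codeMeasure
  infer_instance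

theorem uniformOn_singleton_fin_three (i : Fin 3) :
    ProbabilityTheory.uniformOn (Set.univ : Set (Fin 3)) {i} = 3⁻¹ := by
  rw [ProbabilityTheory.uniformOn_univ]
  simp

theorem codeMeasure_cylinder (s : Finset ℕ) (ω : ℕ → Fin 3) :
    codeMeasure {η | ∀ k ∈ s, η k = ω k} = 3⁻¹ ^ s.card := by
  have h : {η : ℕ → Fin 3 | ∀ k ∈ s, η k = ω k} = Set.pi s fun k => {ω k} := by
    ext η
    simp [Set.mem_pi]
  rw [h, codeMeasure, Measure.infinitePi_pi _ fun _ _ => MeasurableSet.singleton _]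
  simp [uniformOn_singleton_fin_three]

theorem measurableSet_cylinder (s : Finset ℕ) (ω : ℕ → Fin 3) :
    MeasurableSet {η : ℕ → Fin 3 | ∀ k ∈ s, η k = ω k} := by
  have h : {η : ℕ → Fin 3 | ∀ k ∈ s, η k = ω k} = Set.pi s fun k => {ω k} := by
    ext η
    simp [Set.mem_pi]
  rw [h]
  exact MeasurableSet.pi s.countable_toSet fun _ _ => MeasurableSet.singleton _

/-- Self-similarity of the measure. A product measure is determined by its values on boxes, where
coordinate 0 can be split off from the rest. -/
theorem codeMeasure_eq_sum_map :
    codeMeasure = (3⁻¹ : ℝ≥0∞) • ∑ i : Fin 3, codeMeasure.map (consCode i) := by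
  symm
  refine Measure.eq_infinitePi _ fun s t ht => ?_
  have hm : MeasurableSet (Set.pi (s : Set ℕ) t) :=
    MeasurableSet.pi s.countable_toSet fun i _ => ht i
  set u : Finset ℕ := s.preimage Nat.succ Nat.succ_injective.injOn with hu
  have hP : codeMeasure (Set.pi (u : Set ℕ) fun k => t (k + 1))
      = ∏ k ∈ u, ProbabilityTheory.uniformOn (Set.univ : Set (Fin 3)) (t (k + 1)) :=
    Measure.infinitePi_pi _ fun k _ => ht (k + 1)
  have hpre : ∀ i : Fin 3, (0 ∈ s → i ∈ t 0) →
      consCode i ⁻¹' Set.pi (s : Set ℕ) t = Set.pi (u : Set ℕ) fun k => t (k + 1) := by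
    intro i hi
    ext ω
    simp only [Set.mem_preimage, Set.mem_pi, hu, Finset.coe_preimage, Finset.mem_coe]
    refine ⟨fun h k hk => h (k + 1) hk, fun h k hk => ?_⟩
    cases k with
    | zero => exact hi hk
    | succ k => exact h k hk
  simp only [Measure.smul_apply, Measure.finsetSum_apply, smul_eq_mul,
    Measure.map_apply (measurable_consCode _) hm]
  have himg : ∏ k ∈ u, ProbabilityTheory.uniformOn (Set.univ : Set (Fin 3)) (t (k + 1))
      = ∏ k ∈ s.erase 0, ProbabilityTheory.uniformOn (Set.univ : Set (Fin 3)) (t k) := by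
    refine Finset.prod_bij (fun k _ => k + 1) ?_ ?_ ?_ ?_
    · intro k hk
      simpa [hu] using hk
    · intro a _ b _ h
      simpa using h
    · intro b hb
      obtain ⟨hb0, hbs⟩ := Finset.mem_erase.1 hb
      obtain ⟨k, rfl⟩ := Nat.exists_eq_succ_of_ne_zero hb0
      exact ⟨k, by simpa [hu] using hbs, rfl⟩
    · intros
      rfl
  by_cases h0 : 0 ∈ s
  · have hval : ∀ i : Fin 3, codeMeasure (consCode i ⁻¹' Set.pi (s : Set ℕ) t)
        = (t 0).indicator 1 i * codeMeasure (Set.pi (u : Set ℕ) fun k => t (k + 1)) := by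
      intro i
      by_cases hi : i ∈ t 0
      · rw [hpre i fun _ => hi]
        simp [hi]
      · have : consCode i ⁻¹' Set.pi (s : Set ℕ) t = ∅ := by
          ext ω
          simp only [Set.mem_preimage, Set.mem_pi, Set.mem_empty_iff_false, iff_false]
          exact fun h => hi (h 0 h0)
        simp [this, hi]
    simp only [hval, ← Finset.sum_mul]
    rw [hP, himg, ← mul_assoc, ← Finset.mul_prod_erase s _ h0]
    congr 1
    rw [ProbabilityTheory.uniformOn_univ, ← lintegral_indicator_one (ht 0), lintegral_count,
      tsum_fintype, ENNReal.div_eq_inv_mul]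
    simp
  · simp only [hpre _ fun h => absurd h h0, hP, himg, Finset.erase_eq_of_notMem h0]
    simp only [Finset.sum_const, Finset.card_univ, Fintype.card_fin, nsmul_eq_mul, ← mul_assoc]
    norm_num [ENNReal.inv_mul_cancel]

/-- Almost every code contains arbitrarily late runs of `n` zeros. -/
theorem ae_frequently_zero_run (n : ℕ) :
    ∀ᵐ ω ∂codeMeasure, ∀ m : ℕ, ∃ k, m ≤ k ∧ ∀ j < n, ω (k + j) = 0 := by
  rcases Nat.eq_zero_or_pos n with rfl | hn
  · exact Eventually.of_forall fun ω m => ⟨m, le_rfl, by simp⟩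
  -- Disjoint blocks of length n give independent events of equal positive probability, so the
  -- second Borel–Cantelli lemma applies.
  set b : ℕ → Finset ℕ := fun j => (Finset.range n).image (j * n + ·) with hb
  have hmem : ∀ j k, k ∈ b j → k / n = j := by
    intro j k hk
    obtain ⟨a, ha, rfl⟩ := Finset.mem_image.1 hk
    rw [mul_comm, Nat.mul_add_div hn, Nat.div_eq_of_lt (Finset.mem_range.1 ha), add_zero]
  have hcard : ∀ j, (b j).card = n := fun j => by
    rw [hb, Finset.card_image_of_injective _ (add_right_injective _), Finset.card_range]
  set A : ℕ → Set (ℕ → Fin 3) := fun j => {ω | ∀ k ∈ b j, ω k = 0} with hA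
  have hAm : ∀ j, MeasurableSet (A j) := fun j => measurableSet_cylinder (b j) fun _ => 0
  have hAP : ∀ j, codeMeasure (A j) = 3⁻¹ ^ n := fun j => by
    rw [← hcard j]
    exact codeMeasure_cylinder (b j) fun _ => 0
  have hind : ProbabilityTheory.iIndepSet A codeMeasure := by
    refine (ProbabilityTheory.iIndepSet_iff_meas_biInter hAm).2 fun s => ?_
    have : ⋂ j ∈ s, A j = {ω | ∀ k ∈ s.biUnion b, ω k = 0} := by
      ext ω
      simp only [hA, Set.mem_iInter, Set.mem_ofPred_eq, Finset.mem_biUnion]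
      exact ⟨fun h k ⟨j, hj, hk⟩ => h j hj k hk, fun h j hj k hk => h k ⟨j, hj, hk⟩⟩
    have hc := codeMeasure_cylinder (s.biUnion b) fun _ => 0
    rw [this, hc, Finset.card_biUnion]
    · simp [hAP, hcard, pow_mul', Finset.prod_const]
    · intro i _ j _ hij
      refine Finset.disjoint_left.2 fun k hi hj => hij ?_
      rw [← hmem i k hi, hmem j k hj]
  have hsum : ∑' j, codeMeasure (A j) = ∞ := by
    simp only [hAP]
    exact ENNReal.tsum_const_eq_top_of_ne_zero (by simp)
  have hlim := ProbabilityTheory.measure_limsup_eq_one hAm hind hsum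
  have hlm : MeasurableSet (limsup A atTop) := MeasurableSet.measurableSet_limsup hAm
  have hae : ∀ᵐ ω ∂codeMeasure, ω ∈ limsup A atTop := by
    rw [← prob_compl_eq_zero_iff hlm] at hlim
    exact hlim
  filter_upwards [hae] with ω hω m
  rw [mem_limsup_iff_frequently_mem] at hω
  obtain ⟨j, hj, hωj⟩ := (frequently_atTop.1 hω) m
  refine ⟨j * n, hj.trans (Nat.le_mul_of_pos_right j hn), fun a ha => ?_⟩
  exact hωj _ (Finset.mem_image.2 ⟨a, Finset.mem_range.2 ha, rfl⟩)

/-! ### The coding map of the gasket -/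

theorem dist_triangleVertex_le (i j : Fin 3) : dist (triangleVertex i) (triangleVertex j) ≤ 1 := by
  rw [EuclideanSpace.dist_eq, Fin.sum_univ_two]
  refine Real.sqrt_le_iff.2 ⟨zero_le_one, ?_⟩
  have h3 : √3 ^ 2 = 3 := Real.sq_sqrt (by norm_num)
  fin_cases i <;> fin_cases j <;>
    simp [triangleVertex, Real.dist_eq, sq_abs, div_pow, h3] <;> norm_num

/-- The coordinate along the edge from the vertex `i` to the vertex `j`. -/
def edgeCoord (i j : Fin 3) : EuclideanSpace ℝ (Fin 2) →L[ℝ] ℝ :=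
  innerSL ℝ (triangleVertex j - triangleVertex i)

theorem edgeCoord_sub_mem_Icc (i j k : Fin 3) :
    edgeCoord i j (triangleVertex k) - edgeCoord i j (triangleVertex i) ∈ Set.Icc (0 : ℝ) 1 := by
  have h3 : √3 ^ 2 = 3 := Real.sq_sqrt (by norm_num)
  rw [← map_sub, edgeCoord, innerSL_apply_apply, PiLp.inner_apply, Fin.sum_univ_two]
  fin_cases i <;> fin_cases j <;> fin_cases k <;> simp [triangleVertex, div_pow, h3] <;>
    norm_num

theorem edgeCoord_sub_self {i j : Fin 3} (h : i ≠ j) :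
    edgeCoord i j (triangleVertex j) - edgeCoord i j (triangleVertex i) = 1 := by
  have h3 : √3 ^ 2 = 3 := Real.sq_sqrt (by norm_num)
  rw [← map_sub, edgeCoord, innerSL_apply_apply, PiLp.inner_apply, Fin.sum_univ_two]
  fin_cases i <;> fin_cases j <;> simp [triangleVertex, div_pow, h3] at h ⊢ <;>
    norm_num

theorem edgeCoord_sub_le_dist (i j : Fin 3) (x y : EuclideanSpace ℝ (Fin 2)) :
    edgeCoord i j x - edgeCoord i j y ≤ dist x y := by
  rw [← map_sub, dist_eq_norm, edgeCoord, innerSL_apply_apply]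
  refine (real_inner_le_norm _ _).trans ?_
  rw [← dist_eq_norm]
  exact mul_le_of_le_one_left (norm_nonneg _) (dist_triangleVertex_le _ _)

/-- Measured from this corner of cell j, the farthest corner of cell i is the vertex i itself, as
long as r ≤ 1/2. -/
theorem dist_sierpinskiMap_vertex_le {r : ℝ} (h0 : 0 < r) (h1 : r ≤ 1 / 2) {i j : Fin 3}
    (h : i ≠ j) (k : Fin 3) :
    dist (sierpinskiMap r i (triangleVertex k)) (sierpinskiMap r j (triangleVertex i))
      ≤ 1 - r := by
  have h3 : √3 ^ 2 = 3 := Real.sq_sqrt (by norm_num)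
  rw [EuclideanSpace.dist_eq, Fin.sum_univ_two]
  refine Real.sqrt_le_iff.2 ⟨by linarith, ?_⟩
  fin_cases i <;> fin_cases j <;> fin_cases k <;>
    simp [triangleVertex, sierpinskiMap, Real.dist_eq, mul_pow, div_pow, sq_abs, h3] at h ⊢ <;>
    -- For the third corner of cell i, the difference of the squared distances is exactly r(1-2r).
    nlinarith [mul_nonneg h0.le (by linarith : (0 : ℝ) ≤ 1 - 2 * r)]

/-- The point of the gasket with the given code. -/
def gasketPoint (r : ℝ) (ω : ℕ → Fin 3) : EuclideanSpace ℝ (Fin 2) :=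
  ∑' k, ((1 - r) * r ^ k) • triangleVertex (ω k)

theorem hasSum_geometric_weights {r : ℝ} (h0 : 0 < r) (h1 : r < 1) :
    HasSum (fun k : ℕ => (1 - r) * r ^ k) 1 := by
  have h := (hasSum_geometric_of_lt_one h0.le h1).mul_left (1 - r)
  rwa [mul_inv_cancel₀ (by linarith)] at h

theorem norm_weighted_vertex_le {r : ℝ} (h0 : 0 < r) (h1 : r < 1) (k : ℕ) (i : Fin 3) :
    ‖((1 - r) * r ^ k) • triangleVertex i‖ ≤ (1 - r) * r ^ k := by
  have hk : 0 ≤ (1 - r) * r ^ k := mul_nonneg (by linarith) (pow_nonneg h0.le k)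
  have hv : ‖triangleVertex i‖ ≤ 1 := by
    have h := dist_triangleVertex_le i 0
    have h00 : triangleVertex 0 = 0 := by
      ext a
      fin_cases a <;> simp [triangleVertex]
    rwa [h00, dist_zero_right] at h
  rw [norm_smul, Real.norm_of_nonneg hk]
  exact mul_le_of_le_one_right hk hv

theorem hasSum_gasketPoint {r : ℝ} (h0 : 0 < r) (h1 : r < 1) (ω : ℕ → Fin 3) :
    HasSum (fun k => ((1 - r) * r ^ k) • triangleVertex (ω k)) (gasketPoint r ω) :=
  (Summable.of_norm_bounded (hasSum_geometric_weights h0 h1).summable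
    fun k => norm_weighted_vertex_le h0 h1 k (ω k)).hasSum

theorem continuous_gasketPoint {r : ℝ} (h0 : 0 < r) (h1 : r < 1) :
    Continuous (gasketPoint r) := by
  refine continuous_tsum (fun k => ?_) (hasSum_geometric_weights h0 h1).summable
    fun k ω => norm_weighted_vertex_le h0 h1 k (ω k)
  have hk : Continuous fun ω : ℕ → Fin 3 => ω k := continuous_apply k
  have hv : Continuous fun ω : ℕ → Fin 3 => triangleVertex (ω k) :=
    continuous_of_discreteTopology.comp hk
  exact hv.const_smul ((1 - r) * r ^ k)

theorem gasketPoint_consCode {r : ℝ} (h0 : 0 < r) (h1 : r < 1) (i : Fin 3) (ω : ℕ → Fin 3) :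
    gasketPoint r (consCode i ω) = sierpinskiMap r i (gasketPoint r ω) := by
  have h := hasSum_gasketPoint h0 h1 (consCode i ω)
  have h' := (hasSum_nat_add_iff' 1).2 h
  have h2 := (hasSum_gasketPoint h0 h1 ω).const_smul r
  have hterm : (fun k => r • ((1 - r) * r ^ k) • triangleVertex (ω k)) = fun k =>
      ((1 - r) * r ^ (k + 1)) • triangleVertex (consCode i ω (k + 1)) := funext fun k => by
    rw [consCode_succ, smul_smul, pow_succ']
    congr 1
    ring
  rw [hterm] at h2
  rw [sierpinskiMap, h2.unique h']
  simp

theorem gasketPoint_head_tail {r : ℝ} (h0 : 0 < r) (h1 : r < 1) (ω : ℕ → Fin 3) :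
    gasketPoint r ω = sierpinskiMap r (ω 0) (gasketPoint r fun k => ω (k + 1)) := by
  rw [← gasketPoint_consCode h0 h1, consCode_head_tail]

theorem gasketPoint_const {r : ℝ} (h0 : 0 < r) (h1 : r < 1) (i : Fin 3) :
    gasketPoint r (fun _ => i) = triangleVertex i := by
  have h := (hasSum_geometric_weights h0 h1).smul_const (triangleVertex i)
  rw [one_smul] at h
  exact (hasSum_gasketPoint h0 h1 fun _ => i).unique h

theorem range_gasketPoint {r : ℝ} (h0 : 0 < r) (h1 : r < 1) :
    Set.range (gasketPoint r) = sierpinskiGasket r := by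
  refine (isSelfSimilarSet_iff_eq_sierpinskiGasket h0 h1 _).1
    ⟨Set.range_nonempty _, isCompact_range (continuous_gasketPoint h0 h1), ?_⟩
  ext x
  simp only [Set.mem_iUnion, Set.mem_image, Set.mem_range]
  constructor
  · rintro ⟨ω, rfl⟩
    exact ⟨ω 0, _, ⟨_, rfl⟩, (gasketPoint_head_tail h0 h1 ω).symm⟩
  · rintro ⟨i, _, ⟨ω, rfl⟩, rfl⟩
    exact ⟨_, gasketPoint_consCode h0 h1 i ω⟩

/-- A point of the gasket is an infinite convex combination of the vertices, so it lies in every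
closed ball that contains all three. -/
theorem dist_gasketPoint_le {r : ℝ} (h0 : 0 < r) (h1 : r < 1) {c : EuclideanSpace ℝ (Fin 2)}
    {R : ℝ} (hc : ∀ i, dist (triangleVertex i) c ≤ R) (ω : ℕ → Fin 3) :
    dist (gasketPoint r ω) c ≤ R := by
  have hw := hasSum_geometric_weights h0 h1
  have h := (hasSum_gasketPoint h0 h1 ω).sub (hw.smul_const c)
  rw [one_smul] at h
  have hR := hw.mul_right R
  rw [one_mul] at hR
  rw [dist_eq_norm, ← h.tsum_eq]
  refine tsum_of_norm_bounded hR fun k => ?_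
  have hk : 0 ≤ (1 - r) * r ^ k := mul_nonneg (by linarith) (pow_nonneg h0.le k)
  rw [← smul_sub, norm_smul, Real.norm_of_nonneg hk, ← dist_eq_norm]
  exact mul_le_mul_of_nonneg_left (hc _) hk

theorem dist_gasketPoint_gasketPoint_le {r : ℝ} (h0 : 0 < r) (h1 : r < 1) (ω η : ℕ → Fin 3) :
    dist (gasketPoint r ω) (gasketPoint r η) ≤ 1 := by
  refine dist_gasketPoint_le h0 h1 (fun i => ?_) ω
  rw [dist_comm]
  exact dist_gasketPoint_le h0 h1 (fun j => dist_triangleVertex_le j i) η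

theorem edgeCoord_gasketPoint_mem_Icc {r : ℝ} (h0 : 0 < r) (h1 : r < 1) (i j : Fin 3)
    (ω : ℕ → Fin 3) :
    edgeCoord i j (gasketPoint r ω) - edgeCoord i j (triangleVertex i) ∈ Set.Icc (0 : ℝ) 1 := by
  have hw := hasSum_geometric_weights h0 h1
  have h := ((edgeCoord i j).hasSum (hasSum_gasketPoint h0 h1 ω)).sub
    (hw.mul_right (edgeCoord i j (triangleVertex i)))
  rw [one_mul] at h
  have hterm : ∀ k : ℕ, edgeCoord i j (((1 - r) * r ^ k) • triangleVertex (ω k))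
      - (1 - r) * r ^ k * edgeCoord i j (triangleVertex i) = (1 - r) * r ^ k *
        (edgeCoord i j (triangleVertex (ω k)) - edgeCoord i j (triangleVertex i)) := fun k => by
    rw [map_smul, smul_eq_mul, mul_sub]
  have hk : ∀ k : ℕ, 0 ≤ (1 - r) * r ^ k := fun k =>
    mul_nonneg (by linarith) (pow_nonneg h0.le k)
  constructor
  · refine h.nonneg fun k => ?_
    rw [hterm]
    exact mul_nonneg (hk k) (edgeCoord_sub_mem_Icc i j _).1
  · refine hasSum_le (fun k => ?_) h hw
    rw [hterm]
    exact mul_le_of_le_one_right (hk k) (edgeCoord_sub_mem_Icc i j _).2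

theorem dist_sierpinskiMap {r : ℝ} (h0 : 0 < r) (i : Fin 3) (x y : EuclideanSpace ℝ (Fin 2)) :
    dist (sierpinskiMap r i x) (sierpinskiMap r i y) = r * dist x y := by
  simp only [sierpinskiMap, dist_add_right, dist_smul₀, Real.norm_eq_abs, abs_of_pos h0]

theorem edgeCoord_sierpinskiMap (r : ℝ) (i j k : Fin 3) (x : EuclideanSpace ℝ (Fin 2)) :
    edgeCoord i j (sierpinskiMap r k x) - edgeCoord i j (triangleVertex i)
      = r * (edgeCoord i j x - edgeCoord i j (triangleVertex i))
        + (1 - r) * (edgeCoord i j (triangleVertex k) - edgeCoord i j (triangleVertex i)) := by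
  simp only [sierpinskiMap, map_add, map_smul, smul_eq_mul]
  ring

/-- Projected to the edge from `i` to `η 0`, the cell of `η` lies in [1-r, 1], and the vertex is at
0. -/
theorem le_dist_vertex_gasketPoint {r : ℝ} (h0 : 0 < r) (h1 : r < 1) {i : Fin 3} {η : ℕ → Fin 3}
    (h : i ≠ η 0) : 1 - r ≤ dist (triangleVertex i) (gasketPoint r η) := by
  have h2 := edgeCoord_sub_le_dist i (η 0) (gasketPoint r η) (triangleVertex i)
  rw [dist_comm] at h2
  refine le_trans ?_ h2
  rw [gasketPoint_head_tail h0 h1, edgeCoord_sierpinskiMap, edgeCoord_sub_self h]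
  nlinarith [(edgeCoord_gasketPoint_mem_Icc h0 h1 i (η 0) fun k => η (k + 1)).1]

/-- The two cells project to [0, r] and [1-r, 1] on the edge joining their vertices. -/
theorem le_dist_gasketPoint_of_ne {r : ℝ} (h0 : 0 < r) (h1 : r < 1) {ω η : ℕ → Fin 3}
    (h : ω 0 ≠ η 0) : 1 - 2 * r ≤ dist (gasketPoint r ω) (gasketPoint r η) := by
  have h2 := edgeCoord_sub_le_dist (ω 0) (η 0) (gasketPoint r η) (gasketPoint r ω)
  rw [dist_comm] at h2
  have hη := edgeCoord_sierpinskiMap r (ω 0) (η 0) (η 0) (gasketPoint r fun k => η (k + 1))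
  have hω := edgeCoord_sierpinskiMap r (ω 0) (η 0) (ω 0) (gasketPoint r fun k => ω (k + 1))
  rw [← gasketPoint_head_tail h0 h1] at hη hω
  rw [edgeCoord_sub_self h] at hη
  have h3 := (edgeCoord_gasketPoint_mem_Icc h0 h1 (ω 0) (η 0) fun k => η (k + 1)).1
  have h4 := (edgeCoord_gasketPoint_mem_Icc h0 h1 (ω 0) (η 0) fun k => ω (k + 1)).2
  nlinarith

theorem dist_gasketPoint_of_agree {r : ℝ} (h0 : 0 < r) (h1 : r < 1) (n : ℕ) {ω η : ℕ → Fin 3}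
    (h : ∀ k < n, ω k = η k) :
    dist (gasketPoint r ω) (gasketPoint r η)
      = r ^ n * dist (gasketPoint r fun k => ω (n + k)) (gasketPoint r fun k => η (n + k)) := by
  induction n generalizing ω η with
  | zero => simp
  | succ n ih =>
    rw [gasketPoint_head_tail h0 h1 ω, gasketPoint_head_tail h0 h1 η, h 0 n.succ_pos,
      dist_sierpinskiMap h0, ih fun k hk => h (k + 1) (Nat.succ_lt_succ hk), pow_succ']
    simp only [add_right_comm n _ 1, mul_assoc]

/-! ### Lower bound for the mass of balls centred in the gasket -/

theorem rpow_gasketDim {r : ℝ} (h0 : 0 < r) (h1 : r < 1) : r ^ gasketDim r = 3⁻¹ := by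
  have hl : Real.log r ≠ 0 := (Real.log_neg h0 h1).ne
  rw [Real.rpow_def_of_pos h0, gasketDim, mul_div_cancel₀ _ hl, Real.exp_neg,
    Real.exp_log (by norm_num)]

theorem gasketDim_pos {r : ℝ} (h0 : 0 < r) (h1 : r < 1) : 0 < gasketDim r :=
  div_pos_of_neg_of_neg (neg_neg_of_pos (Real.log_pos (by norm_num))) (Real.log_neg h0 h1)

theorem gasketDim_le_one {r : ℝ} (h0 : 0 < r) (h1 : r ≤ 1 / 3) : gasketDim r ≤ 1 := by
  have hl : Real.log r ≤ -Real.log 3 := by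
    rw [← Real.log_inv]
    exact Real.log_le_log h0 (by rwa [← one_div])
  have h3 : 0 < Real.log 3 := Real.log_pos (by norm_num)
  rw [gasketDim, div_le_one_of_neg (by linarith)]
  exact hl

/-- The mass that the natural probability measure of the gasket gives to a closed ball. -/
def ballMass (r : ℝ) (x : EuclideanSpace ℝ (Fin 2)) (d : ℝ) : ℝ :=
  codeMeasure.real {η | dist (gasketPoint r η) x ≤ d}

theorem measurableSet_dist_gasketPoint_le {r : ℝ} (h0 : 0 < r) (h1 : r < 1)
    (x : EuclideanSpace ℝ (Fin 2)) (d : ℝ) :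
    MeasurableSet {η : ℕ → Fin 3 | dist (gasketPoint r η) x ≤ d} :=
  (isClosed_le ((continuous_gasketPoint h0 h1).dist continuous_const)
    continuous_const).measurableSet

theorem ballMass_eq_sum {r : ℝ} (h0 : 0 < r) (h1 : r < 1) (x : EuclideanSpace ℝ (Fin 2)) (d : ℝ) :
    ballMass r x d = 3⁻¹ * ∑ i,
      codeMeasure.real {η | dist (sierpinskiMap r i (gasketPoint r η)) x ≤ d} := by
  have hm := measurableSet_dist_gasketPoint_le h0 h1 x d
  have h : codeMeasure {η | dist (gasketPoint r η) x ≤ d} = 3⁻¹ * ∑ i,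
      codeMeasure {η | dist (sierpinskiMap r i (gasketPoint r η)) x ≤ d} := by
    conv_lhs => rw [codeMeasure_eq_sum_map]
    simp only [Measure.smul_apply, Measure.finsetSum_apply, smul_eq_mul,
      Measure.map_apply (measurable_consCode _) hm, Set.preimage_ofPred_eq,
      gasketPoint_consCode h0 h1]
  rw [ballMass, measureReal_def, h, ENNReal.toReal_mul, ENNReal.toReal_sum (by simp)]
  simp [measureReal_def]

theorem ballMass_of_one_le {r : ℝ} (h0 : 0 < r) (h1 : r < 1) (ω : ℕ → Fin 3) {d : ℝ}
    (hd : 1 ≤ d) : ballMass r (gasketPoint r ω) d = 1 := by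
  have : {η | dist (gasketPoint r η) (gasketPoint r ω) ≤ d} = Set.univ :=
    Set.eq_univ_of_forall fun η => (dist_gasketPoint_gasketPoint_le h0 h1 η ω).trans hd
  rw [ballMass, this, probReal_univ]

/-- Only the part of the ball in the centre's own first-level cell is counted. -/
theorem third_ballMass_tail_le {r : ℝ} (h0 : 0 < r) (h1 : r < 1) (ω : ℕ → Fin 3) (d : ℝ) :
    3⁻¹ * ballMass r (gasketPoint r fun k => ω (k + 1)) (d / r)
      ≤ ballMass r (gasketPoint r ω) d := by
  rw [ballMass_eq_sum h0 h1 (gasketPoint r ω)]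
  refine mul_le_mul_of_nonneg_left ?_ (by norm_num)
  refine le_trans (le_of_eq ?_)
    (Finset.single_le_sum (fun i _ => measureReal_nonneg) (Finset.mem_univ (ω 0)))
  simp only [ballMass]
  congr 1
  ext η
  simp only [Set.mem_ofPred_eq]
  rw [gasketPoint_head_tail h0 h1 ω, dist_sierpinskiMap h0, le_div_iff₀' h0]

theorem dist_gasketPoint_sierpinskiMap_vertex_le {r : ℝ} (h0 : 0 < r) (h1 : r ≤ 1 / 2)
    (ω : ℕ → Fin 3) {j : Fin 3} (hj : ω 0 ≠ j) :
    dist (gasketPoint r ω) (sierpinskiMap r j (triangleVertex (ω 0))) ≤ 1 - r := by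
  have hr1 : r < 1 := by linarith
  -- `c` is the preimage of the corner under the map of cell `ω 0`, so that the bound at three
  -- vertices extends to the whole cell.
  set c := r⁻¹ • (sierpinskiMap r j (triangleVertex (ω 0)) - (1 - r) • triangleVertex (ω 0))
    with hc
  have hcm : sierpinskiMap r (ω 0) c = sierpinskiMap r j (triangleVertex (ω 0)) := by
    rw [sierpinskiMap, hc, smul_inv_smul₀ h0.ne', sub_add_cancel]
  rw [← hcm, gasketPoint_head_tail h0 hr1, dist_sierpinskiMap h0, ← le_div_iff₀' h0]
  refine dist_gasketPoint_le h0 hr1 (fun k => ?_) _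
  rw [le_div_iff₀' h0, ← dist_sierpinskiMap h0 (ω 0), hcm]
  exact dist_sierpinskiMap_vertex_le h0 h1 hj k

/-- The radius 1-r covers the centre's own cell and reaches the corner of each other cell that faces
it; the surplus `t` then covers a ball about that corner. -/
theorem le_ballMass_of_gap {r : ℝ} (h0 : 0 < r) (h1 : r ≤ 1 / 2) (ω : ℕ → Fin 3) {t : ℝ}
    (ht : 0 ≤ t) :
    3⁻¹ * (1 + 2 * ballMass r (triangleVertex (ω 0)) (t / r))
      ≤ ballMass r (gasketPoint r ω) (1 - r + t) := by
  have hr1 : r < 1 := by linarith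
  rw [ballMass_eq_sum h0 hr1 (gasketPoint r ω)]
  refine mul_le_mul_of_nonneg_left ?_ (by norm_num)
  have hown : codeMeasure.real {η |
      dist (sierpinskiMap r (ω 0) (gasketPoint r η)) (gasketPoint r ω) ≤ 1 - r + t} = 1 := by
    have : {η | dist (sierpinskiMap r (ω 0) (gasketPoint r η)) (gasketPoint r ω) ≤ 1 - r + t}
        = Set.univ := by
      refine Set.eq_univ_of_forall fun η => ?_
      rw [Set.mem_ofPred_eq, gasketPoint_head_tail h0 hr1 ω, dist_sierpinskiMap h0]
      nlinarith [dist_gasketPoint_gasketPoint_le h0 hr1 η fun k => ω (k + 1)]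
    rw [this, probReal_univ]
  have hother : ∀ j ∈ Finset.univ.erase (ω 0), ballMass r (triangleVertex (ω 0)) (t / r)
      ≤ codeMeasure.real {η |
        dist (sierpinskiMap r j (gasketPoint r η)) (gasketPoint r ω) ≤ 1 - r + t} := by
    intro j hj
    refine measureReal_mono fun η hη => ?_
    rw [Set.mem_ofPred_eq, le_div_iff₀' h0, ← dist_sierpinskiMap h0 j] at hη
    have h2 := dist_gasketPoint_sierpinskiMap_vertex_le h0 h1 ω (Finset.ne_of_mem_erase hj).symm
    have h3 := dist_triangle_right (sierpinskiMap r j (gasketPoint r η)) (gasketPoint r ω)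
      (sierpinskiMap r j (triangleVertex (ω 0)))
    rw [Set.mem_ofPred_eq]
    linarith
  rw [← Finset.add_sum_erase _ _ (Finset.mem_univ (ω 0)), hown]
  have h4 := Finset.card_nsmul_le_sum _ _ _ hother
  rw [Finset.card_erase_of_mem (Finset.mem_univ _), Finset.card_univ, Fintype.card_fin,
    nsmul_eq_mul] at h4
  norm_num at h4 ⊢
  linarith

/-- A lower bound for the mass of balls over one scale period extends to all smaller scales. -/
theorem le_ballMass_of_scale_period {r : ℝ} (h0 : 0 < r) (h1 : r < 1) {C : Set (ℕ → Fin 3)}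
    (hC : ∀ ω ∈ C, (fun k => ω (k + 1)) ∈ C) {c : ℝ}
    (h : ∀ ω ∈ C, ∀ d, 1 - r < d → d ≤ (1 - r) / r →
      c * (r * d / (1 - r)) ^ gasketDim r ≤ ballMass r (gasketPoint r ω) d)
    {ω : ℕ → Fin 3} (hω : ω ∈ C) {d : ℝ} (hd : 0 < d) (hd' : d ≤ (1 - r) / r) :
    c * (r * d / (1 - r)) ^ gasketDim r ≤ ballMass r (gasketPoint r ω) d := by
  have key : ∀ n : ℕ, ∀ ω ∈ C, ∀ d, (1 - r) * r ^ n < d → d ≤ (1 - r) / r →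
      c * (r * d / (1 - r)) ^ gasketDim r ≤ ballMass r (gasketPoint r ω) d := by
    intro n
    induction n with
    | zero =>
      intro ω hω d hd hd'
      exact h ω hω d (by simpa using hd) hd'
    | succ n ih =>
      intro ω hω d hd hd'
      rcases lt_or_ge (1 - r) d with hlt | hle
      · exact h ω hω d hlt hd'
      have hd0 : 0 < d := lt_of_le_of_lt (mul_nonneg (by linarith) (by positivity)) hd
      -- Zooming in by one letter multiplies the gauge by 3 and the mass bound by at most 3, so the
      -- inequality survives.
      have hi := ih _ (hC ω hω) (d / r)
        (by rw [lt_div_iff₀ h0, mul_assoc, ← pow_succ]; exact hd) (by gcongr)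
      refine le_trans (le_of_eq ?_) ((mul_le_mul_of_nonneg_left hi (by norm_num)).trans
        (third_ballMass_tail_le h0 h1 ω d))
      have hsplit : r * d / (1 - r) = r * (r * (d / r) / (1 - r)) := by
        field_simp
      have hnn : 0 ≤ r * (d / r) / (1 - r) := div_nonneg (by positivity) (by linarith)
      rw [hsplit, Real.mul_rpow h0.le hnn, rpow_gasketDim h0 h1]
      ring
  obtain ⟨n, hn⟩ := exists_pow_lt_of_lt_one (div_pos hd (by linarith : (0 : ℝ) < 1 - r)) h1
  exact key n ω hω d (by rwa [lt_div_iff₀' (by linarith)] at hn) hd'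

theorem gauge_le_one {r d : ℝ} (h0 : 0 < r) (h1 : r < 1) (hd : 0 < d) (hd' : d ≤ (1 - r) / r) :
    (r * d / (1 - r)) ^ gasketDim r ≤ 1 := by
  have h : 0 < 1 - r := by linarith
  refine Real.rpow_le_one (by positivity) ?_ (gasketDim_pos h0 h1).le
  rw [div_le_one h]
  rwa [le_div_iff₀' h0] at hd'

theorem half_gauge_le_ballMass_vertex {r : ℝ} (h0 : 0 < r) (h1 : r ≤ 1 / 3) (i : Fin 3) {d : ℝ}
    (hd : 0 < d) (hd' : d ≤ (1 - r) / r) :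
    2⁻¹ * (r * d / (1 - r)) ^ gasketDim r ≤ ballMass r (triangleVertex i) d := by
  have hr1 : r < 1 := by linarith
  have hr : 0 < 1 - r := by linarith
  rw [← gasketPoint_const h0 hr1 i]
  -- A vertex has a constant code, so this singleton is invariant under the shift.
  refine le_ballMass_of_scale_period h0 hr1 (C := {fun _ => i}) (by simp) ?_ rfl hd hd'
  intro ω _ d hd hd'
  rcases le_or_gt 1 d with h | h
  · rw [ballMass_of_one_le h0 hr1 ω h]
    linarith [gauge_le_one h0 hr1 (hr.trans hd) hd']
  · have h3 := third_ballMass_tail_le h0 hr1 ω d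
    rw [ballMass_of_one_le h0 hr1 _ (by rw [le_div_iff₀ h0]; linarith)] at h3
    have h4 : (r * d / (1 - r)) ^ gasketDim r ≤ 3⁻¹ * (3 / 2) := by
      have hd0 : 0 < d := hr.trans hd
      rw [mul_div_assoc, Real.mul_rpow h0.le (by positivity), rpow_gasketDim h0 hr1]
      refine mul_le_mul_of_nonneg_left ?_ (by norm_num)
      -- Here d < 1 and 1-r ≥ 2/3; with s ≤ 1 the gauge is at most 1/2, while the vertex's own cell
      -- has mass 1/3.
      have h5 : d / (1 - r) ≤ 3 / 2 := by
        rw [div_le_iff₀ hr]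
        linarith
      have h6 : 1 ≤ d / (1 - r) := (one_le_div hr).2 hd.le
      calc (d / (1 - r)) ^ gasketDim r ≤ (d / (1 - r)) ^ (1 : ℝ) :=
            Real.rpow_le_rpow_of_exponent_le h6 (gasketDim_le_one h0 h1)
        _ ≤ 3 / 2 := by rwa [Real.rpow_one]
    linarith

/-- Every ball centred in the gasket, of radius at most `(1 - r) / r`, has at least the mass that
the critical gauge prescribes. -/
theorem gauge_le_ballMass {r : ℝ} (h0 : 0 < r) (h1 : r ≤ 1 / 3) (ω : ℕ → Fin 3) {d : ℝ}
    (hd : 0 < d) (hd' : d ≤ (1 - r) / r) :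
    (r * d / (1 - r)) ^ gasketDim r ≤ ballMass r (gasketPoint r ω) d := by
  have hr1 : r < 1 := by linarith
  have hr : 0 < 1 - r := by linarith
  rw [← one_mul ((r * d / (1 - r)) ^ gasketDim r)]
  refine le_ballMass_of_scale_period h0 hr1 (C := Set.univ) (fun _ _ => trivial) ?_
    (Set.mem_univ ω) hd hd'
  intro ω _ d hd hd'
  rw [one_mul]
  rcases le_or_gt 1 d with h | h
  · rw [ballMass_of_one_le h0 hr1 ω h]
    exact gauge_le_one h0 hr1 (hr.trans hd) hd'
  · set t := d - (1 - r) with ht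
    have ht0 : 0 < t := by linarith
    have hgap := le_ballMass_of_gap h0 (by linarith) ω ht0.le
    have hv := half_gauge_le_ballMass_vertex h0 h1 (ω 0) (div_pos ht0 h0)
      (by gcongr; linarith)
    rw [mul_div_cancel₀ _ h0.ne'] at hv
    have hdt : 1 - r + t = d := by linarith
    rw [hdt] at hgap
    refine le_trans ?_ hgap
    -- The factor 2 for the two other cells cancels the 1/2 in the vertex bound, leaving exactly the
    -- subadditivity of u ↦ u^s.
    have hsub := Real.rpow_add_le_add_rpow zero_le_one (div_pos ht0 hr).le
      (gasketDim_pos h0 hr1).le (gasketDim_le_one h0 h1)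
    rw [Real.one_rpow] at hsub
    have hd1 : d / (1 - r) = 1 + t / (1 - r) := by
      rw [← hdt, add_div, div_self hr.ne']
    have hd0 : 0 < d := hr.trans hd
    rw [mul_div_assoc, Real.mul_rpow h0.le (by positivity), rpow_gasketDim h0 hr1, hd1]
    refine mul_le_mul_of_nonneg_left ?_ (by norm_num)
    linarith

/-! ### The natural measure and the packing measure -/

/-- The natural probability measure of the gasket. -/
def gasketMeasure (r : ℝ) : Measure (EuclideanSpace ℝ (Fin 2)) :=
  codeMeasure.map (gasketPoint r)

theorem measurable_gasketPoint {r : ℝ} (h0 : 0 < r) (h1 : r < 1) : Measurable (gasketPoint r) :=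
  (continuous_gasketPoint h0 h1).measurable

theorem isProbabilityMeasure_gasketMeasure {r : ℝ} (h0 : 0 < r) (h1 : r < 1) :
    IsProbabilityMeasure (gasketMeasure r) :=
  Measure.isProbabilityMeasure_map (measurable_gasketPoint h0 h1).aemeasurable

theorem gasketMeasure_closedBall {r : ℝ} (h0 : 0 < r) (h1 : r < 1)
    (x : EuclideanSpace ℝ (Fin 2)) (d : ℝ) :
    gasketMeasure r (Metric.closedBall x d) = ENNReal.ofReal (ballMass r x d) := by
  rw [gasketMeasure, Measure.map_apply (measurable_gasketPoint h0 h1)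
    Metric.isClosed_closedBall.measurableSet, ballMass, ofReal_measureReal]
  rfl

theorem ediam_closedBall_eq {E : Type*} [NormedAddCommGroup E] [NormedSpace ℝ E] [Nontrivial E]
    (x : E) {d : ℝ} (hd : 0 ≤ d) :
    Metric.ediam (Metric.closedBall x d) = ENNReal.ofReal (2 * d) := by
  rw [← Metric.diam_closedBall_eq x hd, Metric.diam, ENNReal.ofReal_toReal]
  exact Metric.isBounded_closedBall.ediam_ne_top

theorem IsPacking.tsum_measure_eq {n : ℕ} {A : Set (EuclideanSpace ℝ (Fin n))} {δ : ℝ≥0∞}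
    {t : Set (EuclideanSpace ℝ (Fin n) × ℝ)} (ht : IsPacking A δ t)
    (μ : Measure (EuclideanSpace ℝ (Fin n))) :
    ∑' p : t, μ (Metric.closedBall p.1.1 p.1.2) = μ (⋃ p ∈ t, Metric.closedBall p.1 p.2) :=
  (measure_biUnion ht.countable ht.disjoint
    fun _ _ => Metric.isClosed_closedBall.measurableSet).symm

theorem packingPremeasureAt_empty {n : ℕ} (s : ℝ) (δ : ℝ≥0∞) :
    packingPremeasureAt s δ (∅ : Set (EuclideanSpace ℝ (Fin n))) = 0 := by
  refine le_antisymm (iSup₂_le fun t ht => ?_) zero_le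
  have : IsEmpty t := ⟨fun p => ht.center_mem _ p.2⟩
  simp

theorem packingPremeasure_empty {n : ℕ} (s : ℝ) :
    packingPremeasure s (∅ : Set (EuclideanSpace ℝ (Fin n))) = 0 := by
  refine le_antisymm (iInf₂_le_of_le 1 one_pos ?_) zero_le
  rw [packingPremeasureAt_empty]

theorem packingMeasure_le_packingPremeasure {n : ℕ} (s : ℝ)
    (A : Set (EuclideanSpace ℝ (Fin n))) : packingMeasure s A ≤ packingPremeasure s A := by
  refine iInf₂_le_of_le (fun i => if i = 0 then A else ∅) ?_ (le_of_eq ?_)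
  · exact fun x hx => Set.mem_iUnion.2 ⟨0, by simpa using hx⟩
  · rw [tsum_eq_single 0 fun i hi => by simp only [if_neg hi, packingPremeasure_empty]]
    simp only [if_true]

theorem packingPremeasure_gasket_le {r : ℝ} (h0 : 0 < r) (h1 : r ≤ 1 / 3) :
    packingPremeasure (gasketDim r) (sierpinskiGasket r)
      ≤ ENNReal.ofReal ((2 * ((1 - r) / r)) ^ gasketDim r) := by
  have hr1 : r < 1 := by linarith
  have hr : 0 < 1 - r := by linarith
  have := isProbabilityMeasure_gasketMeasure h0 hr1
  set C := (2 * ((1 - r) / r)) ^ gasketDim r with hC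
  have hC0 : 0 ≤ C := by positivity
  -- Diameter at most 1 already forces radius at most 1/2 ≤ (1-r)/r, the range of the mass bound.
  refine iInf₂_le_of_le 1 one_pos (iSup₂_le fun t ht => ?_)
  have hball : ∀ p : t, Metric.ediam (Metric.closedBall p.1.1 p.1.2) ^ gasketDim r
      ≤ ENNReal.ofReal C * gasketMeasure r (Metric.closedBall p.1.1 p.1.2) := by
    rintro ⟨⟨x, d⟩, hp⟩
    have hd : 0 < d := ht.radius_pos _ hp
    have hdiam := ht.ediam_le _ hp
    have hx := ht.center_mem _ hp
    simp only at hdiam hx ⊢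
    rw [← range_gasketPoint h0 hr1] at hx
    obtain ⟨ω, rfl⟩ := hx
    rw [ediam_closedBall_eq _ hd.le, ENNReal.ofReal_le_one] at hdiam
    rw [ediam_closedBall_eq _ hd.le, gasketMeasure_closedBall h0 hr1,
      ENNReal.ofReal_rpow_of_pos (by linarith), ← ENNReal.ofReal_mul hC0]
    refine ENNReal.ofReal_le_ofReal ?_
    have hsplit : 2 * d = 2 * ((1 - r) / r) * (r * d / (1 - r)) := by
      field_simp
    rw [hsplit, Real.mul_rpow (by positivity) (by positivity)]
    refine mul_le_mul_of_nonneg_left (gauge_le_ballMass h0 h1 ω hd ?_) hC0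
    rw [le_div_iff₀ h0]
    nlinarith
  refine (ENNReal.tsum_le_tsum hball).trans ?_
  rw [ENNReal.tsum_mul_left, ht.tsum_measure_eq]
  exact mul_le_of_le_one_right' prob_le_one

/-- If the code has a run of zeros at position `k`, then a ball of radius almost `r ^ k * (1 - r)`
meets only one cylinder of level `k + 1`. -/
theorem ballMass_le_of_zero_run {r : ℝ} (h0 : 0 < r) (h1 : r ≤ 1 / 3) {ω : ℕ → Fin 3} {k n : ℕ}
    (hω : ∀ j < n, ω (k + j) = 0) (hn : 0 < n) {d : ℝ} (hd : 0 < d) (hdn : d + r ^ n < 1 - r) :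
    ballMass r (gasketPoint r ω) (r ^ k * d) ≤ 3⁻¹ ^ (k + 1) := by
  have hr1 : r < 1 := by linarith
  have hcyl : codeMeasure.real {η | ∀ j ∈ Finset.range (k + 1), η j = ω j} = 3⁻¹ ^ (k + 1) := by
    rw [measureReal_def, codeMeasure_cylinder, Finset.card_range, ENNReal.toReal_pow,
      ENNReal.toReal_inv]
    rfl
  rw [← hcyl]
  refine measureReal_mono fun η hη => ?_
  by_contra hne
  simp only [Set.mem_ofPred_eq, Finset.mem_range, not_forall] at hne hη
  have hex : ∃ j, η j ≠ ω j := by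
    obtain ⟨j, -, hj⟩ := hne
    exact ⟨j, hj⟩
  classical
  set j := Nat.find hex with hj
  have hjne : η j ≠ ω j := Nat.find_spec hex
  have hjk : j ≤ k := by
    obtain ⟨i, hi, hine⟩ := hne
    exact (Nat.find_min' hex hine).trans (Nat.lt_succ_iff.1 hi)
  have hagree : ∀ i < j, η i = ω i := fun i hi => not_not.1 (Nat.find_min hex hi)
  rw [dist_gasketPoint_of_agree h0 hr1 j hagree] at hη
  have hrn : 0 < r ^ n := pow_pos h0 n
  rcases hjk.lt_or_eq with hlt | heq
  -- Codes that split before level k are too far apart: the rescaled radius is at most rd < r(1-r) ≤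
  -- 1-2r.
  · have hsep := le_dist_gasketPoint_of_ne h0 hr1 (ω := fun i => η (j + i))
      (η := fun i => ω (j + i)) hjne
    have h2 : r ^ k * d ≤ r ^ j * (r * d) := by
      rw [← mul_assoc, ← pow_succ]
      exact mul_le_mul_of_nonneg_right (pow_le_pow_of_le_one h0.le hr1.le hlt) hd.le
    have h3 := le_of_mul_le_mul_left (hη.trans h2) (pow_pos h0 j)
    nlinarith
  -- For a split exactly at level k, the rescaled centre is within r^n of vertex 0, and the other
  -- cells are at least 1-r from it.
  · rw [heq] at hη hjne
    have h2 := le_of_mul_le_mul_left hη (pow_pos h0 k)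
    have h3 := dist_gasketPoint_of_agree h0 hr1 n (ω := fun i => ω (k + i)) (η := fun _ => 0) hω
    have h4 := dist_gasketPoint_gasketPoint_le h0 hr1 (fun i => ω (k + (n + i))) fun _ => 0
    have h5 := mul_le_of_le_one_right hrn.le h4
    rw [← h3, gasketPoint_const h0 hr1] at h5
    have h6 : (0 : Fin 3) ≠ η (k + 0) := by
      rw [add_zero, ← hω 0 hn, add_zero]
      exact hjne.symm
    have h7 := le_dist_vertex_gasketPoint h0 hr1 (η := fun i => η (k + i)) h6
    have h8 := dist_triangle_left (triangleVertex 0) (gasketPoint r fun i => η (k + i))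
      (gasketPoint r fun i => ω (k + i))
    rw [dist_comm (gasketPoint r fun i => ω (k + i)) (gasketPoint r fun i => η (k + i))] at h8
    linarith

/-- The points at which arbitrarily small balls have mass at most `c⁻¹` times the `s`-th power of
their diameter. -/
def lowDensityPoints {n : ℕ} (μ : Measure (EuclideanSpace ℝ (Fin n))) (s : ℝ) (c : ℝ≥0∞) :
    Set (EuclideanSpace ℝ (Fin n)) :=
  {x | ∀ ε : ℝ, 0 < ε → ∃ ρ, 0 < ρ ∧ ρ < ε ∧
    c * μ (Metric.closedBall x ρ) ≤ Metric.ediam (Metric.closedBall x ρ) ^ s}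

/-- At a zero run starting at k, (2 r^k d)^s = (2d/r)^s 3^{-(k+1)}, and the last factor bounds the
mass of the ball. -/
theorem ae_mem_lowDensityPoints {r : ℝ} (h0 : 0 < r) (h1 : r ≤ 1 / 3) {d : ℝ} (hd : 0 < d)
    (hdr : d < 1 - r) :
    ∀ᵐ ω ∂codeMeasure, gasketPoint r ω ∈
      lowDensityPoints (gasketMeasure r) (gasketDim r)
        (ENNReal.ofReal ((2 * (d / r)) ^ gasketDim r)) := by
  have hr1 : r < 1 := by linarith
  obtain ⟨n, hn⟩ := exists_pow_lt_of_lt_one (show 0 < 1 - r - d by linarith) hr1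
  have hn' : r ^ (n + 1) < 1 - r - d :=
    (pow_le_pow_of_le_one h0.le hr1.le n.le_succ).trans_lt hn
  filter_upwards [ae_frequently_zero_run (n + 1)] with ω hω ε hε
  obtain ⟨m, hm⟩ := exists_pow_lt_of_lt_one (div_pos hε hd) hr1
  obtain ⟨k, hmk, hk⟩ := hω m
  have hpos : 0 < r ^ k * d := by positivity
  refine ⟨r ^ k * d, hpos, ?_, ?_⟩
  · rw [← lt_div_iff₀ hd]
    exact (pow_le_pow_of_le_one h0.le hr1.le hmk).trans_lt hm
  · rw [ediam_closedBall_eq _ hpos.le, gasketMeasure_closedBall h0 hr1,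
      ENNReal.ofReal_rpow_of_pos (by positivity), ← ENNReal.ofReal_mul (by positivity)]
    refine ENNReal.ofReal_le_ofReal ?_
    have hb := ballMass_le_of_zero_run h0 h1 hk n.succ_pos hd (by linarith)
    refine (mul_le_mul_of_nonneg_left hb (by positivity)).trans (le_of_eq ?_)
    have hsplit : 2 * (r ^ k * d) = 2 * (d / r) * r ^ (k + 1) := by
      rw [pow_succ]
      field_simp
    have hpow : (r ^ (k + 1)) ^ gasketDim r = 3⁻¹ ^ (k + 1) := by
      rw [← Real.rpow_natCast, ← Real.rpow_mul h0.le, mul_comm, Real.rpow_mul h0.le,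
        rpow_gasketDim h0 hr1, Real.rpow_natCast]
    rw [hsplit, Real.mul_rpow (x := 2 * (d / r)) (by positivity) (by positivity), hpow]

/-- The balls of low density form a fine cover of these points. Besicovitch's theorem extracts a
disjoint subfamily covering almost all of them, which is a packing of `A`. -/
theorem mul_measure_inter_lowDensityPoints_le {n : ℕ} (μ : Measure (EuclideanSpace ℝ (Fin n)))
    [SFinite μ] (s : ℝ) (c : ℝ≥0∞) (A : Set (EuclideanSpace ℝ (Fin n))) :
    c * μ (A ∩ lowDensityPoints μ s c) ≤ packingPremeasure s A := by
  refine le_iInf₂ fun δ hδ => ?_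
  obtain ⟨a, ha0, haδ⟩ : ∃ a : ℝ, 0 < a ∧ ENNReal.ofReal a ≤ δ := by
    obtain ⟨a, -, ha0, haδ⟩ := ENNReal.lt_iff_exists_real_btwn.1 hδ
    exact ⟨a, ENNReal.ofReal_pos.1 ha0, haδ.le⟩
  obtain ⟨t, htc, htA, htf, htμ, htd⟩ := Besicovitch.exists_disjoint_closedBall_covering_ae_aux μ
    (fun x => {ρ | 0 < ρ ∧ ρ < a / 2 ∧
      c * μ (Metric.closedBall x ρ) ≤ Metric.ediam (Metric.closedBall x ρ) ^ s})
    (A ∩ lowDensityPoints μ s c) (by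
      intro x hx ε hε
      obtain ⟨ρ, hρ, hlt, hle⟩ := hx.2 (min ε (a / 2)) (by positivity)
      exact ⟨ρ, ⟨hρ, hlt.trans_le (min_le_right _ _), hle⟩, hρ, hlt.trans_le (min_le_left _ _)⟩)
  have hpack : IsPacking A δ t := by
    refine ⟨htc, fun p hp => (htA p hp).1, fun p hp => (htf p hp).1, fun p hp => ?_, htd⟩
    refine le_trans ?_ haδ
    obtain ⟨h0, hlt, -⟩ := htf p hp
    rw [← Metric.closedEBall_ofReal h0.le]
    refine Metric.ediam_closedEBall_le.trans ?_
    rw [← ENNReal.ofReal_ofNat 2, ← ENNReal.ofReal_mul zero_le_two]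
    exact ENNReal.ofReal_le_ofReal (by linarith)
  refine le_iSup₂_of_le t hpack ?_
  calc c * μ (A ∩ lowDensityPoints μ s c)
      ≤ c * μ (⋃ p ∈ t, Metric.closedBall p.1 p.2) := by
        gcongr c * ?_
        exact measure_mono_ae (ae_le_set.2 htμ)
    _ = ∑' p : t, c * μ (Metric.closedBall p.1.1 p.1.2) := by
        rw [← hpack.tsum_measure_eq, ENNReal.tsum_mul_left]
    _ ≤ ∑' p : t, Metric.ediam (Metric.closedBall p.1.1 p.1.2) ^ s :=
        ENNReal.tsum_le_tsum fun p => (htf p.1 p.2).2.2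

theorem le_packingMeasure_gasket {r : ℝ} (h0 : 0 < r) (h1 : r ≤ 1 / 3) {d : ℝ} (hd : 0 < d)
    (hdr : d < 1 - r) :
    ENNReal.ofReal ((2 * (d / r)) ^ gasketDim r)
      ≤ packingMeasure (gasketDim r) (sierpinskiGasket r) := by
  have hr1 : r < 1 := by linarith
  have := isProbabilityMeasure_gasketMeasure h0 hr1
  refine le_iInf₂ fun U hU => ?_
  set c := ENNReal.ofReal ((2 * (d / r)) ^ gasketDim r)
  set G := lowDensityPoints (gasketMeasure r) (gasketDim r) c
  have hone : 1 ≤ ∑' i, gasketMeasure r (U i ∩ G) := by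
    calc 1 = codeMeasure Set.univ := measure_univ.symm
      _ ≤ codeMeasure (⋃ i, gasketPoint r ⁻¹' (U i ∩ G)) := by
          refine measure_mono_ae ?_
          filter_upwards [ae_mem_lowDensityPoints h0 h1 hd hdr] with ω hω _
          have hωS : gasketPoint r ω ∈ sierpinskiGasket r := by
            rw [← range_gasketPoint h0 hr1]
            exact Set.mem_range_self ω
          obtain ⟨i, hi⟩ := Set.mem_iUnion.1 (hU hωS)
          exact Set.mem_iUnion.2 ⟨i, hi, hω⟩
      _ ≤ ∑' i, codeMeasure (gasketPoint r ⁻¹' (U i ∩ G)) := measure_iUnion_le _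
      _ ≤ ∑' i, gasketMeasure r (U i ∩ G) := ENNReal.tsum_le_tsum fun i =>
          -- The sets of the cover need not be measurable; this inequality holds for arbitrary sets.
          Measure.le_map_apply (measurable_gasketPoint h0 hr1).aemeasurable _
  calc c = c * 1 := (mul_one c).symm
    _ ≤ c * ∑' i, gasketMeasure r (U i ∩ G) := by gcongr
    _ = ∑' i, c * gasketMeasure r (U i ∩ G) := ENNReal.tsum_mul_left.symm
    _ ≤ ∑' i, packingPremeasure (gasketDim r) (U i) :=
        ENNReal.tsum_le_tsum fun i => mul_measure_inter_lowDensityPoints_le _ _ _ _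

end

theorem theorem2 (r : ℝ) (hr : r ∈ Set.Ioc (0 : ℝ) (1 / 3)) :
    packingMeasure (gasketDim r) (sierpinskiGasket r) =
      ENNReal.ofReal ((2 * ((1 - r) / r)) ^ gasketDim r) := by
  obtain ⟨h0, h1⟩ := hr
  refine le_antisymm ((packingMeasure_le_packingPremeasure _ _).trans
    (packingPremeasure_gasket_le h0 h1)) ?_
  have hlim : Tendsto (fun d : ℝ => ENNReal.ofReal ((2 * (d / r)) ^ gasketDim r))
      (𝓝[<] (1 - r)) (𝓝 (ENNReal.ofReal ((2 * ((1 - r) / r)) ^ gasketDim r))) := by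
    have hc : Continuous fun d : ℝ => ENNReal.ofReal ((2 * (d / r)) ^ gasketDim r) := by
      refine ENNReal.continuous_ofReal.comp (Continuous.rpow_const (by fun_prop) fun _ => ?_)
      exact Or.inr (gasketDim_pos h0 (by linarith)).le
    exact hc.continuousAt.tendsto.mono_left nhdsWithin_le_nhds
  refine le_of_tendsto hlim ?_
  filter_upwards [Ioo_mem_nhdsLT (show (0 : ℝ) < 1 - r by linarith)] with d hd
  exact le_packingMeasure_gasket h0 h1 hd.1 hd.2
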